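/- Let $\mathcal D\subseteq\mathbb R^n$ be open and connected, let $t_0\in\mathbb R$, and let $F:\mathbb R^n\rightrightarrows\mathbb R^n$ be a set-valued map that is locally bounded and outer semicontinuous over $\mathcal D$ (that is, every $x\in\mathcal D$ has a neighbourhood $N$ with $\bigcup_{y\in N}F(y)$ bounded, and $y_i\to x\in\mathcal D$, $q_i\in F(y_i)$, $q_i\to q$ imply $q\in F(x)$), and such that $F(x)$ is nonempty, convex and compact for all $x\in\mathcal D$. *Solutions.* A solution of $\dot x\in F(x)$ over $\mathcal I=[t_0,T)$, $t_0<T\le\infty$, is a locally absolutely continuous $x:\mathcal I\to\mathbb R^n$ with $\dot x(t)\in F(x(t))$ for almost all $t\in\mathcal I$. It is maximal if it has no proper right extension that is also a solution, and complete if $T=\infty$. A set $A\subseteq\mathbb R^n$ is weakly forward invariant if for every $x_0\in A$ some maximal solution with $x(t_0)=x_0$ satisfies $x(t)\in A$ for all $t\in\mathcal I$, and strongly forward invariant if every maximal solution with $x(t_0)\in A$ satisfies $x(t)\in A$ for all $t\in\mathcal I$. *Generalized derivative.* For a locally Lipschitz $V:\mathcal D\to\mathbb R$, the Clarke gradient $\partial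 V(x)$ is the closed convex hull of all limits $\lim_i\nabla V(x_i)$ with $x_i\to x$ and $V$ differentiable at each $x_i$; $V$ is regular if at every $x\in\mathcal D$ and for every $v\in\mathbb R^n$ the one-sided derivative $\lim_{h\downarrow0}\frac{V(x+hv)-V(x)}h$ exists and equals $\limsup_{y\to x,\,h\downarrow0}\frac{V(y+hv)-V(y)}h$. Let $\mathcal U=\{U_i\}_{i=1}^\infty$ be a collection of locally Lipschitz regular functions $U_i:\mathcal D\to\mathbb R$, and put $$\tilde F_{\mathcal U}(x)=\bigcap_{i=1}^\infty\{q\in F(x)\mid \exists a\in\mathbb R:\ p^Tq=a\ \ \forall p\in\partial U_i(x)\}.$$ The $\mathcal U$-generalized derivative of $V$ in the direction(s) $F$ at $x\in\mathcal D$ is $$\dot{\overline V}_{\mathcal U}(x)=\min_{p\in\partial V(x)}\ \max_{q\in\tilde F_{\mathcal U}(x)}p^Tq\ \text{ if } V \text{ is regular},\qquad \dot{\overline V}_{\mathcal U}(x)=\max_{p\in\partial V(x)}\ \max_{q\in\tilde F_{\mathcal U}(x)}p^Tq\ \text{ if } V \text{ is not regular},$$ and $\dot{\overline V}_{\mathcal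 U}(x)=-\infty$ if $\tilde F_{\mathcal U}(x)=\emptyset$. **Theorem.** Let $V:\mathcal D\to\mathbb R$ be locally Lipschitz with $\dot{\overline V}_{\mathcal U}(x)\le0$ for all $x\in\mathcal D$, and let $C\subset\mathcal D$ be compact and strongly forward invariant. Let $E=\{x\in\mathcal D\mid\dot{\overline V}_{\mathcal U}(x)=0\}$ and let $M$ be the largest weakly forward invariant subset of $\overline E\cap C$. Then every maximal solution $x(\cdot)$ of $\dot x\in F(x)$ with $x(t_0)\in C$ is complete and $\lim_{t\to\infty}\operatorname{dist}(x(t),M)=0$, where $\operatorname{dist}(z,M)=\inf_{y\in M}\|z-y\|$ (with $\inf\emptyset=\infty$). -/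

import Mathlib

open Set Filter Topology MeasureTheory
open scoped ENNReal

namespace DiffIncl

/-- The Euclidean space `ℝⁿ`. -/
abbrev Rn (n : ℕ) : Type := EuclideanSpace ℝ (Fin n)

/-! ### Solutions of the autonomous differential inclusion `ẋ ∈ F(x)` -/

/-- The right-open interval `[t₀, T)`, where `T = ∞` is allowed. -/
def interval (t₀ : ℝ) (T : EReal) : Set ℝ := {t : ℝ | t₀ ≤ t ∧ (t : EReal) < T}

/-- `x` is a solution of `ẋ ∈ F(x)` over the interval `[t₀, T)` of nonzero length:
it is locally absolutely continuous there, and for almost every `t` in the interval it is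
differentiable at `t` with `ẋ(t) ∈ F(x(t))`. Values of `x` outside the interval are irrelevant. -/
def IsSolution {n : ℕ} (F : Rn n → Set (Rn n)) (t₀ : ℝ) (T : EReal) (x : ℝ → Rn n) : Prop :=
  (t₀ : EReal) < T ∧
  (∀ a ∈ interval t₀ T, ∀ b ∈ interval t₀ T, AbsolutelyContinuousOnInterval x a b) ∧
  ∀ᵐ t ∂(volume : Measure ℝ), t ∈ interval t₀ T → ∃ v ∈ F (x t), HasDerivAt x v t

/-- `x` is a maximal solution over `[t₀, T)`: it has no proper right extension which is also
a solution. -/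
def IsMaximalSolution {n : ℕ} (F : Rn n → Set (Rn n)) (t₀ : ℝ) (T : EReal) (x : ℝ → Rn n) :
    Prop :=
  IsSolution F t₀ T x ∧
  ¬ ∃ (T' : EReal) (y : ℝ → Rn n), T < T' ∧ IsSolution F t₀ T' y ∧ EqOn y x (interval t₀ T)

/-- `A` is weakly forward invariant: from each point of `A` starts some maximal solution that
stays in `A` on its whole interval of existence. -/
def WeaklyForwardInvariant {n : ℕ} (F : Rn n → Set (Rn n)) (t₀ : ℝ) (A : Set (Rn n)) : Prop :=
  ∀ x₀ ∈ A, ∃ (T : EReal) (x : ℝ → Rn n),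
    IsMaximalSolution F t₀ T x ∧ x t₀ = x₀ ∧ ∀ t ∈ interval t₀ T, x t ∈ A

/-- `A` is strongly forward invariant: each maximal solution that starts in `A` stays in `A` on
its whole interval of existence. -/
def StronglyForwardInvariant {n : ℕ} (F : Rn n → Set (Rn n)) (t₀ : ℝ) (A : Set (Rn n)) : Prop :=
  ∀ (T : EReal) (x : ℝ → Rn n),
    IsMaximalSolution F t₀ T x → x t₀ ∈ A → ∀ t ∈ interval t₀ T, x t ∈ A

/-- `M` is the largest weakly forward invariant subset of `S`. -/
def IsLargestWeaklyForwardInvariant {n : ℕ} (F : Rn n → Set (Rn n)) (t₀ : ℝ)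
    (S M : Set (Rn n)) : Prop :=
  IsGreatest {A : Set (Rn n) | A ⊆ S ∧ WeaklyForwardInvariant F t₀ A} M

/-- The largest weakly forward invariant subset always exists. -/
theorem exists_isLargestWeaklyForwardInvariant {n : ℕ} (F : Rn n → Set (Rn n)) (t₀ : ℝ)
    (S : Set (Rn n)) : ∃ M, IsLargestWeaklyForwardInvariant F t₀ S M := by
  refine ⟨⋃₀ {A | A ⊆ S ∧ WeaklyForwardInvariant F t₀ A}, ⟨?_, ?_⟩, ?_⟩
  · exact sUnion_subset fun A hA => hA.1
  · rintro x₀ ⟨A, hA, hx₀⟩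
    obtain ⟨T, x, hx, h0, hmem⟩ := hA.2 x₀ hx₀
    exact ⟨T, x, hx, h0, fun t ht => ⟨A, hA, hmem t ht⟩⟩
  · intro A hA
    exact subset_sUnion_of_mem hA

/-! ### Properties of set-valued maps -/

/-- `F` is locally bounded over `D`: each point of `D` has a neighbourhood on which the values
of `F` stay in one bounded set. -/
def LocallyBoundedOn {n : ℕ} (F : Rn n → Set (Rn n)) (D : Set (Rn n)) : Prop :=
  ∀ x ∈ D, ∃ N ∈ 𝓝 x, Bornology.IsBounded (⋃ y ∈ N, F y)

/-- The outer limit `limsup_{y → x} F(y)`: all limits of sequences `qᵢ ∈ F(yᵢ)` with `yᵢ → x`. -/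
def outerLimit {n : ℕ} (F : Rn n → Set (Rn n)) (x : Rn n) : Set (Rn n) :=
  {q | ∃ (y w : ℕ → Rn n), Tendsto y atTop (𝓝 x) ∧ (∀ i, w i ∈ F (y i)) ∧
    Tendsto w atTop (𝓝 q)}

/-- `F` is outer semicontinuous over `D`. -/
def OuterSemicontinuousOn {n : ℕ} (F : Rn n → Set (Rn n)) (D : Set (Rn n)) : Prop :=
  ∀ x ∈ D, outerLimit F x ⊆ F x

/-! ### Clarke gradient and regularity -/

/-- The Clarke gradient: the closed convex hull of all limits of gradients `∇V(yᵢ)` along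
sequences `yᵢ → x` of points at which `V` is differentiable. -/
def clarkeGradient {n : ℕ} (V : Rn n → ℝ) (x : Rn n) : Set (Rn n) :=
  closedConvexHull ℝ
    {p | ∃ (y g : ℕ → Rn n), Tendsto y atTop (𝓝 x) ∧ (∀ i, HasGradientAt V (g i) (y i)) ∧
      Tendsto g atTop (𝓝 p)}

/-- Clarke's generalized directional derivative
`V°(x; v) = limsup_{y → x, h ↓ 0} (V(y + h v) - V(y)) / h`. -/
noncomputable def clarkeDirDeriv {n : ℕ} (V : Rn n → ℝ) (x v : Rn n) : ℝ :=
  limsup (fun z : Rn n × ℝ => (V (z.1 + z.2 • v) - V z.1) / z.2) (𝓝 x ×ˢ 𝓝[>] (0 : ℝ))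

/-- `V` is regular at `x` in the sense of Clarke: for each direction `v` the usual one-sided
directional derivative exists and equals the generalized one. -/
def RegularAt {n : ℕ} (V : Rn n → ℝ) (x : Rn n) : Prop :=
  ∀ v : Rn n, Tendsto (fun h : ℝ => (V (x + h • v) - V x) / h) (𝓝[>] (0 : ℝ))
    (𝓝 (clarkeDirDeriv V x v))

/-- `V` is regular on `D`. -/
def RegularOn {n : ℕ} (V : Rn n → ℝ) (D : Set (Rn n)) : Prop := ∀ x ∈ D, RegularAt V x

/-! ### Reduced inclusion and generalized derivative -/

/-- The reduction `G_U^F`: the directions `q ∈ F(x)` for which `p ↦ pᵀ q` is constant on the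
Clarke gradient of `U`. -/
def reduction {n : ℕ} (F : Rn n → Set (Rn n)) (U : Rn n → ℝ) (x : Rn n) : Set (Rn n) :=
  {q | q ∈ F x ∧ ∃ a : ℝ, ∀ p ∈ clarkeGradient U x, inner ℝ p q = a}

/-- The `𝒰`-reduced inclusion for the collection `𝒰 = {U 0, U 1, …}`. -/
def reducedInclusion {n : ℕ} (F : Rn n → Set (Rn n)) (U : ℕ → Rn n → ℝ) (x : Rn n) :
    Set (Rn n) :=
  ⋂ i, reduction F (U i) x

open Classical in
/-- The `𝒰`-generalized derivative at `x` of `V : D → ℝ` in the direction(s) `F`: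
`min_{p ∈ ∂V(x)} max_{q} pᵀ q` if `V` is regular on `D`, and `max_{p ∈ ∂V(x)} max_{q} pᵀ q` if not,
with `q` in the reduced inclusion at `x`. It is extended-real valued; as `∂V(x)` is nonempty for
`x ∈ D`, it is `-∞` there exactly when the reduced inclusion is empty at `x`. -/
noncomputable def genDeriv {n : ℕ} (F : Rn n → Set (Rn n)) (U : ℕ → Rn n → ℝ) (D : Set (Rn n))
    (V : Rn n → ℝ) (x : Rn n) : EReal :=
  if RegularOn V D then
    ⨅ p ∈ clarkeGradient V x, ⨆ q ∈ reducedInclusion F U x, ((inner ℝ p q : ℝ) : EReal)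
  else
    ⨆ p ∈ clarkeGradient V x, ⨆ q ∈ reducedInclusion F U x, ((inner ℝ p q : ℝ) : EReal)

end DiffIncl

namespace DiffIncl

/-! ### Absolutely continuous functions -/

/-! This is LaSalle's argument on the set of limit points of `x` as time tends to infinity. Strong
invariance keeps `x` in the compact set `C`, where velocities are bounded; so `x` is Lipschitz, and
at a finite end time it could be continued by a local solution. Hence it is complete
(`IsMaximalSolution.eq_top`).

Along a solution, `V` has almost everywhere a derivative bounded by the generalized derivative
(`IsSolution.ae_hasDerivAt_comp`): regularity of each `U i` forces the velocity into the reduced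
inclusion. So `V` decreases along `x` to a limit and is constant on the limit points. Through each
limit point runs a complete solution made of limit points
(`IsSolution.exists_solution_of_mapClusterPt`). Along it `V` is constant, so almost every time lies
over `E`, and the starting point lies in `closure E` (`IsSolution.clusterPts_subset`). The limit
points thus form a weakly invariant subset of `closure E ∩ C`, hence of `M`, and compactness gives
convergence.

Both constructions of solutions pass to limits through half-space bounds on increments. These
survive pointwise limits, and by Hahn–Banach they recover `ẋ ∈ F(x)` wherever the limit curve is
differentiable (`mem_of_hasDerivAt_of_halfspace`). -/

theorem _root_.LipschitzWith.comp_absolutelyContinuousOnInterval {X Y : Type*}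
    [PseudoMetricSpace X] [PseudoMetricSpace Y] {K : NNReal} {g : X → Y} (hg : LipschitzWith K g)
    {f : ℝ → X} {a b : ℝ} (hf : AbsolutelyContinuousOnInterval f a b) :
    AbsolutelyContinuousOnInterval (fun t => g (f t)) a b := by
  have h := Tendsto.const_mul (K : ℝ) hf
  rw [mul_zero] at h
  refine squeeze_zero (fun _ => Finset.sum_nonneg fun _ _ => dist_nonneg) (fun E => ?_) h
  rw [Finset.mul_sum]
  exact Finset.sum_le_sum fun i _ => hg.dist_le_mul _ _

/-- An absolutely continuous function with derivative at most `c` almost everywhere grows at most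
like `c t`. -/
theorem _root_.AbsolutelyContinuousOnInterval.sub_le_mul {g : ℝ → ℝ} {a b c : ℝ} (hab : a ≤ b)
    (hg : AbsolutelyContinuousOnInterval g a b)
    (hd : ∀ᵐ t ∂(volume : Measure ℝ), t ∈ Icc a b → ∃ d ≤ c, HasDerivAt g d t) :
    g b - g a ≤ c * (b - a) := by
  rw [← hg.integral_deriv_eq_sub]
  have : ∫ _ in a..b, c = c * (b - a) := by simp [mul_comm]
  rw [← this]
  refine intervalIntegral.integral_mono_ae_restrict hab hg.intervalIntegrable_deriv
    intervalIntegrable_const ?_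
  rw [EventuallyLE, ae_restrict_iff' measurableSet_Icc]
  filter_upwards [hd] with t ht hmem
  obtain ⟨d, hdc, hder⟩ := ht hmem
  rwa [hder.deriv]

variable {n : ℕ}

theorem Icc_subset_interval {t₀ : ℝ} {T : EReal} {a b : ℝ} (ha : a ∈ interval t₀ T)
    (hb : b ∈ interval t₀ T) : Icc a b ⊆ interval t₀ T := fun _ ht =>
  ⟨ha.1.trans ht.1, lt_of_le_of_lt (EReal.coe_le_coe_iff.2 ht.2) hb.2⟩

/-- A linear functional bounded by `c` on the velocities of a solution grows at most like `c t`. -/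
theorem IsSolution.apply_sub_le {F : Rn n → Set (Rn n)} {t₀ : ℝ} {T : EReal} {x : ℝ → Rn n}
    (hx : IsSolution F t₀ T x) {a b : ℝ} (ha : a ∈ interval t₀ T) (hb : b ∈ interval t₀ T)
    (hab : a ≤ b) (f : Rn n →L[ℝ] ℝ) {c : ℝ} (hc : ∀ t ∈ Icc a b, ∀ q ∈ F (x t), f q ≤ c) :
    f (x b) - f (x a) ≤ c * (b - a) := by
  refine AbsolutelyContinuousOnInterval.sub_le_mul (g := fun t => f (x t)) hab
    (f.lipschitz.comp_absolutelyContinuousOnInterval (hx.2.1 a ha b hb)) ?_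
  filter_upwards [hx.2.2] with t ht hmem
  obtain ⟨v, hv, hd⟩ := ht (Icc_subset_interval ha hb hmem)
  exact ⟨f v, hc t hmem v hv, f.hasFDerivAt.comp_hasDerivAt t hd⟩

/-- Testing the increment `x b - x a` against itself as a linear functional bounds its squared norm
by its norm times `L (b - a)`. -/
theorem IsSolution.lipschitzOnWith {F : Rn n → Set (Rn n)} {t₀ : ℝ} {T : EReal} {x : ℝ → Rn n}
    (hx : IsSolution F t₀ T x) {L : NNReal} (hL : ∀ t ∈ interval t₀ T, ∀ q ∈ F (x t), ‖q‖ ≤ L) :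
    LipschitzOnWith L x (interval t₀ T) := by
  have key : ∀ a ∈ interval t₀ T, ∀ b ∈ interval t₀ T, a ≤ b →
      ‖x b - x a‖ ≤ L * (b - a) := by
    intro a ha b hb hab
    have h := hx.apply_sub_le ha hb hab (innerSL ℝ (x b - x a)) (c := ‖x b - x a‖ * L) ?_
    · rw [← map_sub, innerSL_apply_apply, real_inner_self_eq_norm_sq] at h
      rcases (norm_nonneg (x b - x a)).eq_or_lt with h0 | h0
      · rw [← h0]
        exact mul_nonneg L.2 (sub_nonneg.2 hab)
      · nlinarith
    · intro t ht q hq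
      rw [innerSL_apply_apply]
      exact (real_inner_le_norm _ _).trans
        (mul_le_mul_of_nonneg_left (hL t (Icc_subset_interval ha hb ht) q hq) (norm_nonneg _))
  refine LipschitzOnWith.of_dist_le_mul fun a ha b hb => ?_
  rcases le_total a b with hab | hab
  · rw [dist_comm, dist_eq_norm, dist_comm, Real.dist_eq, abs_of_nonneg (sub_nonneg.2 hab)]
    exact key a ha b hb hab
  · rw [dist_eq_norm, Real.dist_eq, abs_of_nonneg (sub_nonneg.2 hab)]
    exact key b hb a ha hab

/-! ### Set-valued maps -/

theorem LocallyBoundedOn.exists_bound {F : Rn n → Set (Rn n)} {D C : Set (Rn n)}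
    (hF : LocallyBoundedOn F D) (hCD : C ⊆ D) (hC : IsCompact C) :
    ∃ L : NNReal, ∀ y ∈ C, ∀ q ∈ F y, ‖q‖ ≤ L := by
  refine hC.induction_on (p := fun S => ∃ L : NNReal, ∀ y ∈ S, ∀ q ∈ F y, ‖q‖ ≤ L)
    ⟨0, by simp⟩ (fun S S' h ⟨L, hL⟩ => ⟨L, fun y hy => hL y (h hy)⟩) ?_ ?_
  · rintro S S' ⟨L, hL⟩ ⟨L', hL'⟩
    refine ⟨max L L', fun y hy q hq => ?_⟩
    rw [NNReal.coe_max]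
    rcases hy with hy | hy
    · exact le_max_of_le_left (hL y hy q hq)
    · exact le_max_of_le_right (hL' y hy q hq)
  · intro y hy
    obtain ⟨N, hN, hb⟩ := hF y (hCD hy)
    obtain ⟨R, hR⟩ := hb.exists_norm_le
    refine ⟨N, mem_nhdsWithin_of_mem_nhds hN, R.toNNReal, fun z hz q hq => ?_⟩
    exact (hR q (mem_iUnion₂.2 ⟨z, hz, hq⟩)).trans (Real.le_coe_toNNReal R)

/-- Upper semicontinuity of support functions. -/
theorem OuterSemicontinuousOn.eventually_apply_le {F : Rn n → Set (Rn n)} {D : Set (Rn n)}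
    (hosc : OuterSemicontinuousOn F D) (hbdd : LocallyBoundedOn F D) {y : Rn n} (hy : y ∈ D)
    (f : Rn n →L[ℝ] ℝ) {c : ℝ} (hc : ∀ q ∈ F y, f q < c) :
    ∀ᶠ z in 𝓝 y, ∀ q ∈ F z, f q ≤ c := by
  by_contra h
  obtain ⟨N, hN, hb⟩ := hbdd y hy
  have h' : ∃ᶠ z in 𝓝 y, (∃ q ∈ F z, c < f q) ∧ z ∈ N := by
    refine Frequently.and_eventually ?_ hN
    simpa [Filter.not_eventually] using h
  obtain ⟨z, hz, hzq⟩ := exists_seq_forall_of_frequently h'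
  choose q hq hcq using fun i => (hzq i).1
  obtain ⟨p, -, φ, hφ, hp⟩ := tendsto_subseq_of_bounded hb (x := q)
    fun i => mem_iUnion₂.2 ⟨z i, (hzq i).2, hq i⟩
  have hpF : p ∈ F y := hosc y hy
    ⟨z ∘ φ, q ∘ φ, hz.comp hφ.tendsto_atTop, fun i => hq _, hp⟩
  refine (hc p hpF).not_ge (ge_of_tendsto ((f.continuous.tendsto p).comp hp) ?_)
  exact Eventually.of_forall fun i => (hcq _).le

/-- Velocities lie in `F` as soon as all closed half-spaces that contain `F` nearby bound the
increments of the curve. -/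
theorem mem_of_hasDerivAt_of_halfspace {F : Rn n → Set (Rn n)} {D : Set (Rn n)}
    (hosc : OuterSemicontinuousOn F D) (hbdd : LocallyBoundedOn F D)
    {z : ℝ → Rn n} {t : ℝ} {v : Rn n} (hz : HasDerivAt z v t) (hzD : z t ∈ D)
    (hconv : Convex ℝ (F (z t))) (hcl : IsClosed (F (z t)))
    (H : ∀ (f : Rn n →L[ℝ] ℝ) (c : ℝ), (∀ᶠ y in 𝓝 (z t), ∀ q ∈ F y, f q ≤ c) →
      ∀ᶠ h in 𝓝[>] (0 : ℝ), f (z (t + h)) - f (z t) ≤ c * h) : v ∈ F (z t) := by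
  by_contra hv
  -- The strict separation leaves room for the bound `f ≤ c` to hold on `F` at nearby points; the
  -- right derivative of `f ∘ z` then yields `f v ≤ c`.
  obtain ⟨f, c, hlt, hgt⟩ := geometric_hahn_banach_closed_point hconv hcl hv
  refine hgt.not_ge ?_
  have hd : HasDerivAt (fun s => f (z s)) (f v) t := f.hasFDerivAt.comp_hasDerivAt t hz
  have hd' := hd.tendsto_slope_zero_right
  refine le_of_tendsto hd' ?_
  filter_upwards [H f c (hosc.eventually_apply_le hbdd hzD f hlt), self_mem_nhdsWithin] with h hh h0
  rw [smul_eq_mul, inv_mul_le_iff₀ h0, mul_comm h]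
  exact hh

/-! ### Local existence -/

/-- The Euler scheme `y ↦ y + g(y) / k`. -/
noncomputable def euler (g : Rn n → Rn n) (x₀ : Rn n) (k j : ℕ) : Rn n :=
  (fun y => y + (k : ℝ)⁻¹ • g y)^[j] x₀

theorem euler_succ (g : Rn n → Rn n) (x₀ : Rn n) (k j : ℕ) :
    euler g x₀ k (j + 1) = euler g x₀ k j + (k : ℝ)⁻¹ • g (euler g x₀ k j) :=
  Function.iterate_succ_apply' _ _ _

/-- Summing the steps turns a bound on velocities into one on point values, which is stable under
pointwise limits even where `g` is discontinuous. -/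
theorem apply_euler_sub_le (g : Rn n → Rn n) (x₀ : Rn n) (k : ℕ) (f : Rn n →L[ℝ] ℝ) {c : ℝ}
    {i j : ℕ} (hij : i ≤ j) (hc : ∀ m, i ≤ m → m ≤ j → f (g (euler g x₀ k m)) ≤ c) :
    f (euler g x₀ k j) - f (euler g x₀ k i) ≤ c * ((j : ℝ) / k - (i : ℝ) / k) := by
  induction j, hij using Nat.le_induction with
  | base => simp
  | succ j hj ih =>
    have h1 := ih fun m h h' => hc m h (h'.trans j.le_succ)
    have h2 := mul_le_mul_of_nonneg_left (hc j hj j.le_succ) (inv_nonneg.2 (Nat.cast_nonneg (α := ℝ) k))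
    rw [euler_succ, map_add, map_smul, smul_eq_mul]
    push_cast
    rw [add_div, one_div]
    linarith

theorem norm_euler_sub_le {g : Rn n → Rn n} {L : NNReal} (hg : ∀ y, ‖g y‖ ≤ L) (x₀ : Rn n) (k : ℕ)
    {i j : ℕ} (hij : i ≤ j) :
    ‖euler g x₀ k j - euler g x₀ k i‖ ≤ L * ((j : ℝ) / k - (i : ℝ) / k) := by
  induction j, hij using Nat.le_induction with
  | base => simp
  | succ j hj ih =>
    have h2 := mul_le_mul_of_nonneg_left (hg (euler g x₀ k j)) (inv_nonneg.2 (Nat.cast_nonneg (α := ℝ) k))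
    have h3 : ‖(k : ℝ)⁻¹ • g (euler g x₀ k j)‖ = (k : ℝ)⁻¹ * ‖g (euler g x₀ k j)‖ := by
      rw [norm_smul, Real.norm_of_nonneg (inv_nonneg.2 (Nat.cast_nonneg (α := ℝ) k))]
    rw [euler_succ, add_sub_right_comm]
    refine (norm_add_le _ _).trans ?_
    rw [h3]
    push_cast
    rw [add_div, one_div]
    linarith

theorem floor_mul_div_sub_le {u t : ℝ} (hut : u ≤ t) {k : ℕ} (hk : 0 < k) :
    (⌊t * k⌋₊ : ℝ) / k - (⌊u * k⌋₊ : ℝ) / k ≤ t - u + (k : ℝ)⁻¹ := by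
  have hk' : (0 : ℝ) < k := Nat.cast_pos.2 hk
  rw [← sub_div, div_le_iff₀ hk', add_mul, inv_mul_cancel₀ hk'.ne', sub_mul]
  have hle : u * k ≤ t * k := mul_le_mul_of_nonneg_right hut hk'.le
  rcases le_or_gt 0 (t * k) with h | h
  · linarith [Nat.floor_le h, Nat.lt_floor_add_one (u * k)]
  · rw [Nat.floor_of_nonpos h.le, Nat.floor_of_nonpos (hle.trans h.le)]
    simp only [Nat.cast_zero]
    linarith

theorem norm_euler_floor_sub_le {g : Rn n → Rn n} {L : NNReal} (hg : ∀ y, ‖g y‖ ≤ L) (x₀ : Rn n)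
    {k : ℕ} (hk : 0 < k) (t u : ℝ) :
    ‖euler g x₀ k ⌊t * k⌋₊ - euler g x₀ k ⌊u * k⌋₊‖ ≤ L * (|t - u| + (k : ℝ)⁻¹) := by
  wlog hut : u ≤ t generalizing t u
  · rw [norm_sub_rev, abs_sub_comm]
    exact this u t (le_of_not_ge hut)
  rw [abs_of_nonneg (sub_nonneg.2 hut)]
  exact (norm_euler_sub_le hg x₀ k (Nat.floor_le_floor
    (mul_le_mul_of_nonneg_right hut (Nat.cast_nonneg k)))).trans
    (mul_le_mul_of_nonneg_left (floor_mul_div_sub_le hut hk) L.2)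

/-- Limits of Euler polygons of a bounded, possibly discontinuous vector field `g` satisfy every
half-space bound which `g` satisfies locally. -/
theorem exists_lipschitz_euler_limit (g : Rn n → Rn n) (L : NNReal) (hg : ∀ y, ‖g y‖ ≤ L)
    (x₀ : Rn n) : ∃ z : ℝ → Rn n, LipschitzWith L z ∧ z 0 = x₀ ∧
      ∀ t, 0 ≤ t → ∀ (f : Rn n →L[ℝ] ℝ) (c : ℝ), (∀ᶠ y in 𝓝 (z t), f (g y) ≤ c) →
        ∀ᶠ h in 𝓝[>] (0 : ℝ), f (z (t + h)) - f (z t) ≤ c * h := by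
  -- An ultrafilter gives limits at all times at once, in place of Arzelà–Ascoli and a subsequence.
  let 𝒰 : Ultrafilter ℕ := Ultrafilter.of atTop
  have h𝒰 : (𝒰 : Filter ℕ) ≤ atTop := Ultrafilter.of_le _
  let Z : ℕ → ℝ → Rn n := fun k t => euler g x₀ k ⌊t * k⌋₊
  have hpos : ∀ᶠ k : ℕ in 𝒰, 0 < k := h𝒰 (eventually_gt_atTop 0)
  have hinv : Tendsto (fun k : ℕ => (k : ℝ)⁻¹) 𝒰 (𝓝 0) :=
    tendsto_inv_atTop_nhds_zero_nat.mono_left h𝒰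
  have hZ0 : ∀ k, Z k 0 = x₀ := fun k => by simp [Z, euler]
  have hex : ∀ t, ∃ y, Tendsto (fun k => Z k t) 𝒰 (𝓝 y) := by
    intro t
    have hmem : ∀ᶠ k in 𝒰, Z k t ∈ Metric.closedBall x₀ (L * (|t| + 1)) := by
      filter_upwards [hpos] with k hk
      rw [mem_closedBall_iff_norm]
      have h := norm_euler_floor_sub_le hg x₀ hk t 0
      have h1 : (k : ℝ)⁻¹ ≤ 1 := inv_le_one_of_one_le₀ (by exact_mod_cast hk)
      have h2 : Z k t - x₀ = Z k t - Z k 0 := by rw [hZ0]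
      rw [h2]
      refine h.trans (mul_le_mul_of_nonneg_left ?_ L.2)
      rw [sub_zero]
      linarith
    obtain ⟨y, -, hy⟩ := (isCompact_closedBall x₀ (L * (|t| + 1))).ultrafilter_le_nhds
      (𝒰.map fun k => Z k t) (le_principal_iff.2 hmem)
    exact ⟨y, hy⟩
  choose z hz using hex
  refine ⟨z, LipschitzWith.of_dist_le_mul fun t u => ?_,
    tendsto_nhds_unique (hz 0) (by simp only [hZ0]; exact tendsto_const_nhds), ?_⟩
  · have hlim : Tendsto (fun k : ℕ => (L : ℝ) * (|t - u| + (k : ℝ)⁻¹)) 𝒰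
        (𝓝 (L * (|t - u| + 0))) := (tendsto_const_nhds.add hinv).const_mul _
    rw [add_zero] at hlim
    rw [Real.dist_eq]
    refine le_of_tendsto_of_tendsto ((hz t).dist (hz u)) hlim ?_
    filter_upwards [hpos] with k hk
    rw [dist_eq_norm]
    exact norm_euler_floor_sub_le hg x₀ hk t u
  · intro t ht f c hc
    obtain ⟨δ, hδ, hball⟩ := Metric.eventually_nhds_iff_ball.1 hc
    have hsmall : ∀ᶠ h in 𝓝[>] (0 : ℝ), (L : ℝ) * h < δ / 2 := by
      have : Tendsto (fun h : ℝ => (L : ℝ) * h) (𝓝[>] 0) (𝓝 (L * 0)) :=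
        (tendsto_id.const_mul _).mono_left nhdsWithin_le_nhds
      rw [mul_zero] at this
      exact this.eventually_lt_const (half_pos hδ)
    filter_upwards [hsmall, self_mem_nhdsWithin] with h hh h0
    have h0 : 0 < h := h0
    have hfl : ∀ s : ℝ, 0 ≤ s → Tendsto (fun k : ℕ => (⌊s * k⌋₊ : ℝ) / k) 𝒰 (𝓝 s) := fun s hs =>
      ((tendsto_nat_floor_mul_div_atTop hs).comp tendsto_natCast_atTop_atTop).mono_left h𝒰
    have hL : Tendsto (fun k => f (Z k (t + h)) - f (Z k t)) 𝒰 (𝓝 (f (z (t + h)) - f (z t))) :=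
      ((f.continuous.tendsto _).comp (hz (t + h))).sub ((f.continuous.tendsto _).comp (hz t))
    have hR : Tendsto (fun k : ℕ => c * ((⌊(t + h) * k⌋₊ : ℝ) / k - (⌊t * k⌋₊ : ℝ) / k)) 𝒰
        (𝓝 (c * (t + h - t))) := ((hfl _ (by linarith)).sub (hfl t ht)).const_mul c
    rw [add_sub_cancel_left] at hR
    refine le_of_tendsto_of_tendsto hL hR ?_
    -- During a time `h` the scheme moves by at most about `L h < δ / 2`, so for most `k` it stays
    -- where `f ∘ g ≤ c`.
    have hnear : ∀ᶠ k in 𝒰, dist (Z k t) (z t) + L * (h + (k : ℝ)⁻¹) < δ := by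
      have h1 : Tendsto (fun k : ℕ => dist (Z k t) (z t) + L * (h + (k : ℝ)⁻¹)) 𝒰
          (𝓝 (dist (z t) (z t) + L * (h + 0))) :=
        ((hz t).dist tendsto_const_nhds).add ((tendsto_const_nhds.add hinv).const_mul _)
      refine h1.eventually_lt_const ?_
      rw [dist_self, zero_add, add_zero]
      linarith
    filter_upwards [hnear, hpos] with k hk hkpos
    have hle : t ≤ t + h := by linarith
    refine apply_euler_sub_le g x₀ k f (Nat.floor_le_floor
      (mul_le_mul_of_nonneg_right hle (Nat.cast_nonneg k))) fun m hm hm' => hball _ ?_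
    rw [Metric.mem_ball]
    refine lt_of_le_of_lt (dist_triangle _ (Z k t) _) (lt_of_le_of_lt ?_ hk)
    rw [add_comm, dist_eq_norm]
    refine add_le_add_right ((norm_euler_sub_le hg x₀ k hm).trans
      (mul_le_mul_of_nonneg_left ?_ L.2)) _
    have h3 := floor_mul_div_sub_le hle hkpos
    have h4 : (m : ℝ) / k ≤ (⌊(t + h) * k⌋₊ : ℝ) / k :=
      div_le_div_of_nonneg_right (Nat.cast_le.2 hm') (Nat.cast_nonneg k)
    rw [add_sub_cancel_left] at h3
    linarith

/-- Local existence of solutions of differential inclusions. -/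
theorem exists_local_solution {F : Rn n → Set (Rn n)} {D : Set (Rn n)} (hD : IsOpen D)
    (hbdd : LocallyBoundedOn F D) (hosc : OuterSemicontinuousOn F D)
    (hval : ∀ x ∈ D, (F x).Nonempty ∧ Convex ℝ (F x) ∧ IsCompact (F x)) {x₀ : Rn n} (hx₀ : x₀ ∈ D)
    (a : ℝ) : ∃ ε > 0, ∃ (L : NNReal) (z : ℝ → Rn n), LipschitzWith L z ∧ z a = x₀ ∧
      ∀ᵐ t ∂(volume : Measure ℝ), t ∈ Ico a (a + ε) → ∃ v ∈ F (z t), HasDerivAt z v t := by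
  classical
  obtain ⟨N, hN, hNb⟩ := hbdd x₀ hx₀
  obtain ⟨R, hR⟩ := hNb.exists_norm_le
  obtain ⟨r, hr, hball⟩ := Metric.mem_nhds_iff.1 (inter_mem hN (hD.mem_nhds hx₀))
  choose! s hs using fun x hx => (hval x hx).1
  -- The cutoff makes the selection globally bounded. It does no harm, as only times at which the
  -- limit curve is in the ball are used.
  let g : Rn n → Rn n := fun y => if y ∈ Metric.ball x₀ r then s y else 0
  have hg : ∀ y, ‖g y‖ ≤ R.toNNReal := by
    intro y
    by_cases hy : y ∈ Metric.ball x₀ r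
    · simp only [g, if_pos hy]
      exact (hR _ (mem_iUnion₂.2 ⟨y, (hball hy).1, hs y (hball hy).2⟩)).trans
        (Real.le_coe_toNNReal R)
    · simp only [g, if_neg hy, norm_zero, NNReal.coe_nonneg]
  obtain ⟨z, hzL, hz0, hz⟩ := exists_lipschitz_euler_limit g _ hg x₀
  have hcont : ∀ᶠ t in 𝓝 (0 : ℝ), z t ∈ Metric.ball x₀ r :=
    hzL.continuous.continuousAt.eventually_mem (by rw [hz0]; exact Metric.ball_mem_nhds _ hr)
  obtain ⟨ε, hε, hεb⟩ := Metric.eventually_nhds_iff_ball.1 hcont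
  let y : ℝ → Rn n := fun t => z (t - a)
  have hyL : LipschitzWith (R.toNNReal * 1) y :=
    hzL.comp (LipschitzWith.of_dist_le_mul fun p q => by simp)
  refine ⟨ε, hε, _, y, hyL, by simp [y, hz0], ?_⟩
  filter_upwards [hyL.ae_differentiableAt_real] with t ht hta
  have hta0 : 0 ≤ t - a := sub_nonneg.2 hta.1
  have hmem : z (t - a) ∈ Metric.ball x₀ r := by
    refine hεb _ ?_
    rw [Metric.mem_ball, Real.dist_eq, sub_zero, abs_of_nonneg hta0]
    linarith [hta.2]
  have hyD : y t ∈ D := (hball hmem).2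
  refine ⟨deriv y t, ?_, ht.hasDerivAt⟩
  refine mem_of_hasDerivAt_of_halfspace hosc hbdd ht.hasDerivAt hyD (hval _ hyD).2.1
    (hval _ hyD).2.2.isClosed fun f c hc => ?_
  have hgc : ∀ᶠ y in 𝓝 (z (t - a)), f (g y) ≤ c := by
    filter_upwards [hc, Metric.isOpen_ball.mem_nhds hmem] with w hw hwb
    simp only [g, if_pos hwb]
    exact hw _ (hs w (hball hwb).2)
  filter_upwards [hz (t - a) hta0 f c hgc] with h hh
  have : t + h - a = t - a + h := by ring
  simpa only [y, this] using hh

/-! ### Solutions in compact sets -/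

theorem interval_top (t₀ : ℝ) : interval t₀ ⊤ = Ici t₀ := by
  ext t
  simp [interval, EReal.coe_lt_top]

theorem interval_coe (t₀ T : ℝ) : interval t₀ (T : EReal) = Ico t₀ T := by
  ext t
  simp [interval]

theorem ae_ne (a : ℝ) : ∀ᵐ t ∂(volume : Measure ℝ), t ≠ a := by
  simp [ae_iff, measure_singleton]

theorem IsSolution.isMaximalSolution_top {F : Rn n → Set (Rn n)} {t₀ : ℝ} {x : ℝ → Rn n}
    (hx : IsSolution F t₀ ⊤ x) : IsMaximalSolution F t₀ ⊤ x :=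
  ⟨hx, fun ⟨_, _, h, _⟩ => not_top_lt h⟩

/-- A maximal solution that stays in a compact set is complete. -/
theorem IsMaximalSolution.eq_top {F : Rn n → Set (Rn n)} {D : Set (Rn n)} (hD : IsOpen D)
    (hbdd : LocallyBoundedOn F D) (hosc : OuterSemicontinuousOn F D)
    (hval : ∀ x ∈ D, (F x).Nonempty ∧ Convex ℝ (F x) ∧ IsCompact (F x))
    {C : Set (Rn n)} (hCD : C ⊆ D) (hC : IsCompact C) {t₀ : ℝ} {T : EReal} {x : ℝ → Rn n}
    (hx : IsMaximalSolution F t₀ T x) (hxC : ∀ t ∈ interval t₀ T, x t ∈ C) : T = ⊤ := by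
  by_contra hT
  obtain ⟨hsol, hmax⟩ := hx
  have hlt := hsol.1
  lift T to ℝ using ⟨hT, (bot_le.trans_lt hlt).ne'⟩
  rw [EReal.coe_lt_coe_iff] at hlt
  obtain ⟨L, hL⟩ := hbdd.exists_bound hCD hC
  have hlip := hsol.lipschitzOnWith fun t ht => hL _ (hxC t ht)
  obtain ⟨X, hX, hEq⟩ := hlip.extend_finite_dimension
  rw [interval_coe] at hEq hxC
  have hXC : X T ∈ C := by
    have hcl : closure (Ico t₀ T) = Icc t₀ T := closure_Ico hlt.ne
    have hT' : T ∈ closure (Ico t₀ T) := by rw [hcl]; exact right_mem_Icc.2 hlt.le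
    exact hC.isClosed.closure_subset_iff.2 Subset.rfl
      (map_mem_closure hX.continuous hT' fun t ht => (hEq ht) ▸ hxC t ht)
  obtain ⟨ε, hε, L', z, hz, hzT, hzF⟩ := exists_local_solution hD hbdd hosc hval (hCD hXC) T
  -- This formula for the concatenation at `X T = z T` makes its Lipschitz continuity immediate.
  let y : ℝ → Rn n := fun t => X (min t T) + z (max t T) - X T
  have hyX : ∀ t, t ≤ T → y t = X t := fun t ht => by simp [y, min_eq_left ht, max_eq_right ht, hzT]
  have hyz : ∀ t, T ≤ t → y t = z t := fun t ht => by simp [y, min_eq_right ht, max_eq_left ht]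
  have hy : ∃ K, LipschitzWith K y :=
    ⟨_, ((hX.comp (LipschitzWith.id.min_const T)).add
      (hz.comp (LipschitzWith.id.max_const T))).sub (LipschitzWith.const (X T))⟩
  obtain ⟨K, hy⟩ := hy
  refine hmax ⟨((T + ε : ℝ) : EReal), y, EReal.coe_lt_coe_iff.2 (by linarith),
    ⟨EReal.coe_lt_coe_iff.2 (by linarith),
      fun a _ b _ => (hy.lipschitzOnWith (s := uIcc a b)).absolutelyContinuousOnInterval, ?_⟩, ?_⟩
  -- The endpoints are discarded because a two-sided derivative there would also depend on values
  -- outside the piece.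
  · filter_upwards [hsol.2.2, hzF, ae_ne T, ae_ne t₀] with t hxt hzt htT htt₀ hmem
    rw [interval_coe] at hmem hxt
    rcases lt_or_gt_of_ne htT with h | h
    · obtain ⟨v, hv, hd⟩ := hxt ⟨hmem.1, h⟩
      have hyx : ∀ s ∈ Ico t₀ T, y s = x s := fun s hs => by rw [hyX s hs.2.le, hEq hs]
      refine ⟨v, by rwa [hyx t ⟨hmem.1, h⟩], hd.congr_of_eventuallyEq ?_⟩
      filter_upwards [Ico_mem_nhds (lt_of_le_of_ne hmem.1 htt₀.symm) h] with s hs using hyx s hs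
    · obtain ⟨v, hv, hd⟩ := hzt ⟨h.le, hmem.2⟩
      refine ⟨v, by rwa [hyz t h.le], hd.congr_of_eventuallyEq ?_⟩
      filter_upwards [lt_mem_nhds h] with s hs using hyz s hs.le
  · rw [interval_coe]
    exact fun t ht => by rw [hyX t ht.2.le, hEq ht]

/-- Through each limit point of a complete solution in a compact set runs a complete solution that
consists of limit points. -/
theorem IsSolution.exists_solution_of_mapClusterPt {F : Rn n → Set (Rn n)} {D : Set (Rn n)}
    (hbdd : LocallyBoundedOn F D) (hosc : OuterSemicontinuousOn F D)
    (hval : ∀ x ∈ D, (F x).Nonempty ∧ Convex ℝ (F x) ∧ IsCompact (F x))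
    {C : Set (Rn n)} (hCD : C ⊆ D) (hC : IsCompact C) {t₀ : ℝ} {x : ℝ → Rn n}
    (hx : IsSolution F t₀ ⊤ x) (hxC : ∀ t, t₀ ≤ t → x t ∈ C) {y : Rn n}
    (hy : MapClusterPt y atTop x) :
    ∃ z, IsSolution F t₀ ⊤ z ∧ z t₀ = y ∧ ∀ t, MapClusterPt (z t) atTop x := by
  -- The new solution is the limit of the time shifts of `x` along `𝒰`. Using `max s t₀` freezes it
  -- before `t₀`, so that it is Lipschitz on all of `ℝ`.
  obtain ⟨𝒰, h𝒰, hxy⟩ := mapClusterPt_iff_ultrafilter.1 hy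
  obtain ⟨L, hL⟩ := hbdd.exists_bound hCD hC
  have hlip := hx.lipschitzOnWith (L := L) fun t ht => hL _ (hxC t ht.1)
  rw [interval_top] at hlip
  have hshift : ∀ s : ℝ, 0 ≤ max s t₀ - t₀ := fun s => sub_nonneg.2 (le_max_right _ _)
  have hτ : ∀ᶠ τ in 𝒰, t₀ ≤ τ := h𝒰 (eventually_ge_atTop t₀)
  have hex : ∀ s : ℝ, ∃ w ∈ C, Tendsto (fun τ => x (τ + (max s t₀ - t₀))) 𝒰 (𝓝 w) := by
    intro s
    refine hC.ultrafilter_le_nhds (𝒰.map fun τ => x (τ + (max s t₀ - t₀))) (le_principal_iff.2 ?_)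
    have : ∀ᶠ τ in 𝒰, x (τ + (max s t₀ - t₀)) ∈ C := by
      filter_upwards [hτ] with τ h using hxC _ (by linarith [hshift s])
    exact this
  choose z hzC hz using hex
  have hzL : LipschitzWith L z := by
    refine LipschitzWith.of_dist_le_mul fun s u => ?_
    refine le_of_tendsto ((hz s).dist (hz u)) ?_
    filter_upwards [hτ] with τ h
    refine (hlip.dist_le_mul _ (mem_Ici.2 (by linarith [hshift s])) _
      (mem_Ici.2 (by linarith [hshift u]))).trans (mul_le_mul_of_nonneg_left ?_ L.2)
    rw [dist_add_left, dist_sub_right]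
    simpa using (LipschitzWith.id.max_const t₀).dist_le_mul s u
  refine ⟨z, ⟨EReal.coe_lt_top _,
    fun a _ b _ => (hzL.lipschitzOnWith (s := uIcc a b)).absolutelyContinuousOnInterval, ?_⟩,
    tendsto_nhds_unique (hz t₀) (by simpa using hxy), fun t => ?_⟩
  · filter_upwards [hzL.ae_differentiableAt_real] with t ht hmem
    refine ⟨deriv z t, ?_, ht.hasDerivAt⟩
    have hD := hCD (hzC t)
    refine mem_of_hasDerivAt_of_halfspace hosc hbdd ht.hasDerivAt hD (hval _ hD).2.1
      (hval _ hD).2.2.isClosed fun f c hc => ?_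
    obtain ⟨δ, hδ, hball⟩ := Metric.eventually_nhds_iff_ball.1 hc
    have hsmall : ∀ᶠ h in 𝓝[>] (0 : ℝ), (L : ℝ) * h < δ / 2 := by
      have : Tendsto (fun h : ℝ => (L : ℝ) * h) (𝓝[>] 0) (𝓝 (L * 0)) :=
        (tendsto_id.const_mul _).mono_left nhdsWithin_le_nhds
      rw [mul_zero] at this
      exact this.eventually_lt_const (half_pos hδ)
    filter_upwards [hsmall, self_mem_nhdsWithin] with h hh h0
    have h0 : 0 < h := h0
    have hlim : Tendsto (fun τ => f (x (τ + (max (t + h) t₀ - t₀))) - f (x (τ + (max t t₀ - t₀))))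
        𝒰 (𝓝 (f (z (t + h)) - f (z t))) :=
      ((f.continuous.tendsto _).comp (hz (t + h))).sub ((f.continuous.tendsto _).comp (hz t))
    refine le_of_tendsto hlim ?_
    have hnear := (hz t).eventually (Metric.ball_mem_nhds (z t) (half_pos hδ))
    filter_upwards [hτ, hnear] with τ hτ hn
    have e1 : max t t₀ = t := max_eq_left hmem.1
    have e2 : max (t + h) t₀ = t + h := max_eq_left (by linarith [hmem.1])
    rw [e1] at hn
    rw [e1, e2]
    have hmem1 := hmem.1
    have key := hx.apply_sub_le (a := τ + (t - t₀)) (b := τ + (t + h - t₀)) (c := c)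
      (by rw [interval_top, mem_Ici]; linarith) (by rw [interval_top, mem_Ici]; linarith)
      (by linarith) f fun s hs q hq => hball (x s) ?_ q hq
    · refine key.trans_eq ?_
      ring
    · rw [Metric.mem_ball]
      have hd := hlip.dist_le_mul s (mem_Ici.2 (by linarith [hs.1])) (τ + (t - t₀))
        (mem_Ici.2 (by linarith))
      rw [Real.dist_eq, abs_of_nonneg (by linarith [hs.1])] at hd
      have : (L : ℝ) * (s - (τ + (t - t₀))) ≤ L * h :=
        mul_le_mul_of_nonneg_left (by linarith [hs.2]) L.2
      linarith [dist_triangle (x s) (x (τ + (t - t₀))) (z t)]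
  · refine mapClusterPt_iff_ultrafilter.2 ⟨𝒰.map fun τ => τ + (max t t₀ - t₀), ?_, hz t⟩
    exact (tendsto_atTop_add_const_right _ _ tendsto_id).mono_left h𝒰

/-! ### Clarke gradients along curves -/

theorem _root_.LocallyLipschitzOn.exists_ball {X Y : Type*} [PseudoMetricSpace X]
    [PseudoMetricSpace Y] {D : Set X} (hD : IsOpen D) {V : X → Y} (hV : LocallyLipschitzOn D V)
    {x : X} (hx : x ∈ D) : ∃ K, ∃ r > 0, LipschitzOnWith K V (Metric.ball x r) := by
  obtain ⟨K, s, hs, hK⟩ := hV hx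
  rw [hD.nhdsWithin_eq hx] at hs
  obtain ⟨r, hr, hrs⟩ := Metric.mem_nhds_iff.1 hs
  exact ⟨K, r, hr, hK.mono hrs⟩

theorem tendsto_add_smul (x v : Rn n) :
    Tendsto (fun z : Rn n × ℝ => z.1 + z.2 • v) (𝓝 x ×ˢ 𝓝[>] (0 : ℝ)) (𝓝 x) := by
  have h : Tendsto (fun z : Rn n × ℝ => z.1 + z.2 • v) (𝓝 (x, 0)) (𝓝 (x + (0 : ℝ) • v)) :=
    Continuous.tendsto (by fun_prop) (x, (0 : ℝ))
  rw [zero_smul, add_zero, nhds_prod_eq] at h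
  exact h.mono_left (prod_mono_right _ nhdsWithin_le_nhds)

theorem isBounded_clarke_quotient {V : Rn n → ℝ} {K : NNReal} {x : Rn n} {s : Set (Rn n)}
    (hs : s ∈ 𝓝 x) (hV : LipschitzOnWith K V s) (v : Rn n) :
    ∀ᶠ z : Rn n × ℝ in 𝓝 x ×ˢ 𝓝[>] (0 : ℝ), (V (z.1 + z.2 • v) - V z.1) / z.2 ≤ K * ‖v‖ := by
  filter_upwards [tendsto_add_smul x v hs, tendsto_fst hs, tendsto_snd self_mem_nhdsWithin]
    with z h1 h2 h3
  have h3 : 0 < z.2 := h3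
  rw [div_le_iff₀ h3]
  refine (le_abs_self _).trans ?_
  have h := hV.dist_le_mul _ h1 _ h2
  rw [Real.dist_eq, dist_eq_norm, add_sub_cancel_left, norm_smul, Real.norm_of_nonneg h3.le] at h
  linarith

theorem _root_.HasGradientAt.hasDerivAt_line {V : Rn n → ℝ} {g y : Rn n} (h : HasGradientAt V g y)
    (v : Rn n) : HasDerivAt (fun s : ℝ => V (y + s • v)) (inner ℝ g v) 0 := by
  have hl : HasDerivAt (fun s : ℝ => y + s • v) v 0 := by
    simpa using ((hasDerivAt_id (0 : ℝ)).smul_const v).const_add y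
  have h' : HasFDerivAt V (InnerProductSpace.toDual ℝ (Rn n) g) (y + (0 : ℝ) • v) := by
    rw [zero_smul, add_zero]
    exact h.hasFDerivAt
  exact h'.comp_hasDerivAt (0 : ℝ) hl

theorem tendsto_quotient_of_hasDerivAt {V : Rn n → ℝ} {x v : Rn n} {d : ℝ}
    (h : HasDerivAt (fun s : ℝ => V (x + s • v)) d 0) :
    Tendsto (fun s : ℝ => (V (x + s • v) - V x) / s) (𝓝[>] 0) (𝓝 d) := by
  refine h.tendsto_slope_zero_right.congr fun s => ?_
  simp [div_eq_inv_mul]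

/-- Clarke's generalized directional derivative dominates the Clarke gradient. -/
theorem inner_le_clarkeDirDeriv {V : Rn n → ℝ} {K : NNReal} {x : Rn n} {s : Set (Rn n)}
    (hs : s ∈ 𝓝 x) (hV : LipschitzOnWith K V s) {p : Rn n} (hp : p ∈ clarkeGradient V x)
    (v : Rn n) : inner ℝ p v ≤ clarkeDirDeriv V x v := by
  have hconv : Convex ℝ {p : Rn n | inner ℝ p v ≤ clarkeDirDeriv V x v} :=
    convex_halfSpace_le ⟨fun a b => inner_add_left a b v, fun c a => by
      rw [real_inner_smul_left, smul_eq_mul]⟩ _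
  have hclosed : IsClosed {p : Rn n | inner ℝ p v ≤ clarkeDirDeriv V x v} :=
    isClosed_le (by fun_prop) continuous_const
  refine closedConvexHull_min ?_ hconv hclosed hp
  rintro p ⟨y, g, hy, hg, hgp⟩
  rw [mem_ofPred_eq, clarkeDirDeriv, limsup_eq]
  -- The Lipschitz bound ensures that the real infimum defining the `limsup` is not over the empty
  -- set. Below, `curry` fixes the base point `y i` before `h` tends to zero.
  refine le_csInf ⟨_, isBounded_clarke_quotient hs hV v⟩ fun a ha => ?_
  refine le_of_tendsto (hgp.inner tendsto_const_nhds) ?_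
  filter_upwards [hy.eventually ha.curry] with i hi
  exact le_of_tendsto (tendsto_quotient_of_hasDerivAt ((hg i).hasDerivAt_line v)) hi

/-- For locally Lipschitz functions, differentiability along a curve is differentiability along
its tangent line. -/
theorem hasDerivAt_line_of_curve {V : Rn n → ℝ} {K : NNReal} {s : Set (Rn n)}
    {γ : ℝ → Rn n} {t : ℝ} {v : Rn n} (hs : s ∈ 𝓝 (γ t)) (hV : LipschitzOnWith K V s)
    (hγ : HasDerivAt γ v t) {d : ℝ} (hd : HasDerivAt (fun u => V (γ u)) d t) :
    HasDerivAt (fun h : ℝ => V (γ t + h • v)) d 0 := by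
  have hl : Tendsto (fun h : ℝ => γ t + h • v) (𝓝 0) (𝓝 (γ t)) := by
    have : Tendsto (fun h : ℝ => γ t + h • v) (𝓝 0) (𝓝 (γ t + (0 : ℝ) • v)) :=
      Continuous.tendsto (by fun_prop) 0
    simpa using this
  have hadd : Tendsto (fun h : ℝ => t + h) (𝓝 0) (𝓝 t) := by
    have : Tendsto (fun h : ℝ => t + h) (𝓝 0) (𝓝 (t + 0)) := Continuous.tendsto (by fun_prop) 0
    simpa using this
  have hc : Tendsto (fun h : ℝ => γ (t + h)) (𝓝 0) (𝓝 (γ t)) := hγ.continuousAt.tendsto.comp hadd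
  have h1 := hasDerivAt_iff_isLittleO_nhds_zero.1 hd
  have h2 := hasDerivAt_iff_isLittleO_nhds_zero.1 hγ
  rw [hasDerivAt_iff_isLittleO_nhds_zero]
  have h3 : (fun h : ℝ => V (γ t + h • v) - V (γ (t + h))) =O[𝓝 0]
      fun h : ℝ => γ (t + h) - γ t - h • v := by
    refine Asymptotics.IsBigO.of_bound K ?_
    filter_upwards [hl hs, hc hs] with h ha hb
    have := hV.dist_le_mul _ ha _ hb
    rw [dist_comm (γ t + h • v), dist_eq_norm, dist_eq_norm] at this
    rwa [sub_sub]
  refine ((h3.trans_isLittleO h2).add h1).congr_left fun h => ?_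
  simp only [zero_add, zero_smul, add_zero]
  ring

/-- Along a curve, a regular function has the derivative `pᵀ v` for all Clarke gradients `p`. -/
theorem RegularAt.inner_eq {V : Rn n → ℝ} {K : NNReal} {x : Rn n} {s : Set (Rn n)}
    (hreg : RegularAt V x) (hs : s ∈ 𝓝 x) (hV : LipschitzOnWith K V s) {v : Rn n} {d : ℝ}
    (hd : HasDerivAt (fun h : ℝ => V (x + h • v)) d 0) {p : Rn n} (hp : p ∈ clarkeGradient V x) :
    inner ℝ p v = d := by
  have h1 : clarkeDirDeriv V x v = d :=
    tendsto_nhds_unique (hreg v) (tendsto_quotient_of_hasDerivAt hd)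
  -- The bound by Clarke's derivative in the directions `v` and `-v` pins `pᵀ v` from both sides.
  have hd' : HasDerivAt (fun h : ℝ => V (x + h • -v)) (-d) 0 := by
    have h0 : HasDerivAt (fun h : ℝ => V (x + h • v)) d (-0) := by rwa [neg_zero]
    have := h0.scomp (0 : ℝ) (hasDerivAt_neg (0 : ℝ))
    simpa [Function.comp_def] using this
  have h2 : clarkeDirDeriv V x (-v) = -d :=
    tendsto_nhds_unique (hreg (-v)) (tendsto_quotient_of_hasDerivAt hd')
  have h3 := inner_le_clarkeDirDeriv hs hV hp v
  have h4 := inner_le_clarkeDirDeriv hs hV hp (-v)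
  rw [inner_neg_right] at h4
  linarith

/-- Gradients near `x` are bounded by `K`; violations at points tending to `x` would accumulate at
an element of the Clarke gradient. -/
theorem eventually_inner_gradient_le {V : Rn n → ℝ} {K : NNReal} {x : Rn n} {r : ℝ} (hr : 0 < r)
    (hV : LipschitzOnWith K V (Metric.ball x r)) {v : Rn n} {s : ℝ}
    (hs : ∀ p ∈ clarkeGradient V x, inner ℝ p v < s) :
    ∀ᶠ y in 𝓝 x, ∀ g, HasGradientAt V g y → inner ℝ g v ≤ s := by
  by_contra h
  have h' : ∃ᶠ y in 𝓝 x, (∃ g, HasGradientAt V g y ∧ s < inner ℝ g v) ∧ y ∈ Metric.ball x r := by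
    refine Frequently.and_eventually ?_ (Metric.ball_mem_nhds x hr)
    simpa [Filter.not_eventually] using h
  obtain ⟨y, hy, hyg⟩ := exists_seq_forall_of_frequently h'
  choose g hg hgs using fun i => (hyg i).1
  have hb : ∀ i, g i ∈ Metric.closedBall (0 : Rn n) K := fun i => by
    have := (hg i).hasFDerivAt.le_of_lipschitzOn (Metric.isOpen_ball.mem_nhds (hyg i).2) hV
    rw [LinearIsometryEquiv.norm_map] at this
    rwa [mem_closedBall_zero_iff]
  obtain ⟨p, -, φ, hφ, hp⟩ := tendsto_subseq_of_bounded Metric.isBounded_closedBall hb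
  have hpc : p ∈ clarkeGradient V x := subset_closedConvexHull
    ⟨y ∘ φ, g ∘ φ, hy.comp hφ.tendsto_atTop, fun i => hg _, hp⟩
  exact (hs p hpc).not_ge (ge_of_tendsto (hp.inner tendsto_const_nhds)
    (Eventually.of_forall fun i => (hgs _).le))

/-- A set of full measure meets almost all parallel lines in a set of full measure. -/
theorem ae_ae_add_smul {P : Rn n → Prop} (hP : MeasurableSet {y | P y})
    (h : ∀ᵐ y ∂(volume : Measure (Rn n)), P y) (v : Rn n) :
    ∀ᵐ y ∂(volume : Measure (Rn n)), ∀ᵐ τ ∂(volume : Measure ℝ), P (y + τ • v) := by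
  have hmeas : MeasurableSet {q : ℝ × Rn n | P (q.2 + q.1 • v)} :=
    (show Measurable fun q : ℝ × Rn n => q.2 + q.1 • v by fun_prop) hP
  refine (Measure.ae_ae_comm (p := fun (τ : ℝ) (y : Rn n) => P (y + τ • v)) hmeas).1 ?_
  exact Eventually.of_forall fun τ =>
    (measurePreserving_add_right volume (τ • v)).quasiMeasurePreserving.ae h

/-- The derivative along a line is at most the support function of the Clarke gradient. -/
theorem le_of_forall_clarkeGradient_inner_lt {V : Rn n → ℝ} {K : NNReal} {x : Rn n} {r : ℝ}
    (hr : 0 < r) (hV : LipschitzOnWith K V (Metric.ball x r)) {v : Rn n} {d : ℝ}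
    (hd : HasDerivAt (fun h : ℝ => V (x + h • v)) d 0) {s : ℝ}
    (hs : ∀ p ∈ clarkeGradient V x, inner ℝ p v < s) : d ≤ s := by
  obtain ⟨ρ, hρ, hball⟩ := Metric.eventually_nhds_iff_ball.1
    ((eventually_inner_gradient_le hr hV hs).and (Metric.ball_mem_nhds x hr))
  -- A global Lipschitz extension admits Rademacher's theorem; by Fubini, for a dense set of `y`,
  -- `W` is differentiable at almost all points of the line through `y` in direction `v`.
  obtain ⟨W, hW, hVW⟩ := (hV.mono fun y hy => (hball y hy).2).extend_real
  have hdense := Measure.dense_of_ae (ae_ae_add_smul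
    (measurableSet_of_differentiableAt ℝ W) (hW.ae_differentiableAt (μ := volume)) v)
  have hsmall : ∀ᶠ h in 𝓝[>] (0 : ℝ), h * ‖v‖ < ρ / 2 := by
    have : Tendsto (fun h : ℝ => h * ‖v‖) (𝓝[>] 0) (𝓝 (0 * ‖v‖)) :=
      (tendsto_id.mul_const _).mono_left nhdsWithin_le_nhds
    rw [zero_mul] at this
    exact this.eventually_lt_const (half_pos hρ)
  refine le_of_tendsto (tendsto_quotient_of_hasDerivAt hd) ?_
  filter_upwards [hsmall, self_mem_nhdsWithin] with h hh h0
  have h0 : 0 < h := h0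
  have hseg : ∀ y ∈ Metric.ball x (ρ / 2), ∀ τ ∈ Icc 0 h, y + τ • v ∈ Metric.ball x ρ := by
    intro y hy τ hτ
    rw [mem_ball_iff_norm] at hy ⊢
    have e : y + τ • v - x = (y - x) + τ • v := by abel
    have h1 := norm_add_le (y - x) (τ • v)
    rw [norm_smul, Real.norm_of_nonneg hτ.1] at h1
    have h2 := mul_le_mul_of_nonneg_right hτ.2 (norm_nonneg v)
    rw [e]
    linarith
  have hclosed : IsClosed {y : Rn n | W (y + h • v) - W y ≤ s * h} := by
    have := hW.continuous
    exact isClosed_le (by fun_prop) continuous_const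
  -- The line through `x` itself may miss the differentiability points, so the increment is bounded
  -- from nearby good base points and then by continuity.
  have hxmem : x ∈ {y : Rn n | W (y + h • v) - W y ≤ s * h} := by
    refine hclosed.closure_subset_iff.2 ?_
      (hdense.open_subset_closure_inter Metric.isOpen_ball (Metric.mem_ball_self (half_pos hρ)))
    rintro y ⟨hyb, hy⟩
    have hac : AbsolutelyContinuousOnInterval (fun τ : ℝ => W (y + τ • v)) 0 h := by
      have hl : LipschitzWith ‖v‖₊ fun τ : ℝ => y + τ • v :=
        LipschitzWith.of_dist_le_mul fun a b => by
          rw [dist_add_left, dist_eq_norm, ← sub_smul, norm_smul, mul_comm, Real.dist_eq]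
          rfl
      exact ((hW.comp hl).lipschitzOnWith (s := uIcc 0 h)).absolutelyContinuousOnInterval
    have hle := hac.sub_le_mul (c := s) h0.le ?_
    · simpa using hle
    · filter_upwards [hy] with τ hτ hmem
      have hb := hseg y hyb τ hmem
      have hgW : HasGradientAt W (gradient W (y + τ • v)) (y + τ • v) := hτ.hasGradientAt
      have hgV : HasGradientAt V (gradient W (y + τ • v)) (y + τ • v) :=
        hgW.congr_of_eventuallyEq (hVW.eventuallyEq_of_mem (Metric.isOpen_ball.mem_nhds hb))
      refine ⟨_, (hball _ hb).1 _ hgV, ?_⟩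
      have hl : HasDerivAt (fun τ : ℝ => y + τ • v) v τ := by
        simpa using ((hasDerivAt_id τ).smul_const v).const_add y
      exact hgW.hasFDerivAt.comp_hasDerivAt τ hl
  have hx1 := hVW (Metric.mem_ball_self hρ)
  have hx2 := hVW (hseg x (Metric.mem_ball_self (half_pos hρ)) h (right_mem_Icc.2 h0.le))
  rw [div_le_iff₀ h0, hx1, hx2]
  exact hxmem

/-! ### Lyapunov functions along solutions -/

/-- Along solutions in compact sets, the derivative of a locally Lipschitz function exists almost
everywhere and is at most the generalized derivative. -/
theorem IsSolution.ae_hasDerivAt_comp {F : Rn n → Set (Rn n)} {D : Set (Rn n)} (hD : IsOpen D)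
    {U : ℕ → Rn n → ℝ} (hU : ∀ i, LocallyLipschitzOn D (U i) ∧ RegularOn (U i) D)
    {V : Rn n → ℝ} (hV : LocallyLipschitzOn D V) {C : Set (Rn n)} (hCD : C ⊆ D) (hC : IsCompact C)
    {t₀ : ℝ} {x : ℝ → Rn n} (hx : IsSolution F t₀ ⊤ x) (hxC : ∀ t, t₀ ≤ t → x t ∈ C)
    {L : NNReal} (hlip : LipschitzOnWith L x (Ici t₀)) :
    ∀ᵐ t ∂(volume : Measure ℝ), t ∈ Ici t₀ →
      ∃ d : ℝ, HasDerivAt (fun s => V (x s)) d t ∧ (d : EReal) ≤ genDeriv F U D V (x t) := by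
  have hdiff : ∀ W : Rn n → ℝ, LocallyLipschitzOn D W → ∀ᵐ t ∂(volume : Measure ℝ), t ∈ Ioi t₀ →
      DifferentiableAt ℝ (fun s => W (x s)) t := by
    intro W hW
    obtain ⟨K, hK⟩ := (hW.mono hCD).exists_lipschitzOnWith_of_compact hC
    filter_upwards [(hK.comp hlip fun t ht => hxC t ht).ae_differentiableWithinAt_of_mem_real]
      with t ht hmem
    exact (ht (mem_Ici.2 (le_of_lt hmem))).differentiableAt (Ici_mem_nhds hmem)
  filter_upwards [hdiff V hV, ae_all_iff.2 fun i => hdiff (U i) (hU i).1, hx.2.2, ae_ne t₀]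
    with t htV htU htx htne hmem
  have hgt : t ∈ Ioi t₀ := lt_of_le_of_ne hmem htne.symm
  obtain ⟨v, hv, hxv⟩ := htx (by rwa [interval_top])
  have hxD : x t ∈ D := hCD (hxC t hmem)
  refine ⟨_, (htV hgt).hasDerivAt, ?_⟩
  obtain ⟨K, r, hr, hK⟩ := hV.exists_ball hD hxD
  have hVline := hasDerivAt_line_of_curve (Metric.ball_mem_nhds _ hr) hK hxv (htV hgt).hasDerivAt
  have hred : v ∈ reducedInclusion F U (x t) := by
    -- The constant is the derivative of `U i` along `x`, which by regularity equals `pᵀ v` for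
    -- every Clarke gradient `p`.
    refine mem_iInter.2 fun i => ⟨hv, deriv (fun s => U i (x s)) t, fun p hp => ?_⟩
    obtain ⟨Ki, ri, hri, hKi⟩ := (hU i).1.exists_ball hD hxD
    exact ((hU i).2 _ hxD).inner_eq (Metric.ball_mem_nhds _ hri) hKi
      (hasDerivAt_line_of_curve (Metric.ball_mem_nhds _ hri) hKi hxv (htU i hgt).hasDerivAt) hp
  rw [genDeriv]
  split_ifs with hreg
  · refine le_iInf₂ fun p hp => le_iSup₂_of_le v hred (EReal.coe_le_coe_iff.2 ?_)
    exact ((hreg _ hxD).inner_eq (Metric.ball_mem_nhds _ hr) hK hVline hp).ge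
  -- Without regularity `pᵀ v` may vary with `p`; only the support function of the Clarke gradient
  -- bounds the derivative, which is why a maximum over `p` is used.
  · by_contra hlt
    obtain ⟨s, hs1, hs2⟩ := EReal.lt_iff_exists_real_btwn.1 (not_le.1 hlt)
    refine (EReal.coe_lt_coe_iff.1 hs2).not_ge
      (le_of_forall_clarkeGradient_inner_lt hr hK hVline fun p hp => ?_)
    rw [← EReal.coe_lt_coe_iff]
    refine lt_of_le_of_lt ?_ hs1
    exact le_iSup₂_of_le p hp (le_iSup₂_of_le (f := fun q _ => ((inner ℝ p q : ℝ) : EReal))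
      v hred le_rfl)

/-- Limit points of a complete solution in a compact set are limits of points at which the
generalized derivative vanishes. -/
theorem IsSolution.clusterPts_subset {F : Rn n → Set (Rn n)} {D : Set (Rn n)} (hD : IsOpen D)
    (hbdd : LocallyBoundedOn F D) (hosc : OuterSemicontinuousOn F D)
    (hval : ∀ x ∈ D, (F x).Nonempty ∧ Convex ℝ (F x) ∧ IsCompact (F x))
    {U : ℕ → Rn n → ℝ} (hU : ∀ i, LocallyLipschitzOn D (U i) ∧ RegularOn (U i) D)
    {V : Rn n → ℝ} (hV : LocallyLipschitzOn D V) (hVle : ∀ x ∈ D, genDeriv F U D V x ≤ 0)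
    {C : Set (Rn n)} (hCD : C ⊆ D) (hC : IsCompact C)
    {t₀ : ℝ} {x : ℝ → Rn n} (hx : IsSolution F t₀ ⊤ x) (hxC : ∀ t, t₀ ≤ t → x t ∈ C) {y : Rn n}
    (hy : MapClusterPt y atTop x) :
    y ∈ closure {y | y ∈ D ∧ genDeriv F U D V y = 0} := by
  obtain ⟨L, hL⟩ := hbdd.exists_bound hCD hC
  have hlip : ∀ {z : ℝ → Rn n}, IsSolution F t₀ ⊤ z → (∀ t, t₀ ≤ t → z t ∈ C) →
      LipschitzOnWith L z (Ici t₀) := fun hz hzC => by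
    have := hz.lipschitzOnWith (L := L) fun t ht => hL _ (hzC t ht.1)
    rwa [interval_top] at this
  obtain ⟨K, hK⟩ := (hV.mono hCD).exists_lipschitzOnWith_of_compact hC
  have hanti : Antitone fun t => V (x (max t t₀)) := by
    intro a b hab
    have hab' : max a t₀ ≤ max b t₀ := max_le_max_right t₀ hab
    have hac : AbsolutelyContinuousOnInterval (fun t => V (x t)) (max a t₀) (max b t₀) := by
      refine ((hK.comp (hlip hx hxC) fun t ht => hxC t ht).mono ?_).absolutelyContinuousOnInterval
      rw [uIcc_of_le hab']
      exact fun t ht => (le_max_right _ _).trans ht.1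
    have h := hac.sub_le_mul (c := 0) hab' ?_
    · simpa using h
    · filter_upwards [hx.ae_hasDerivAt_comp hD hU hV hCD hC hxC (hlip hx hxC)] with t ht hmem
      have ht0 : t₀ ≤ t := (le_max_right _ _).trans hmem.1
      obtain ⟨d, hd, hle⟩ := ht ht0
      exact ⟨d, EReal.coe_nonpos.1 (hle.trans (hVle _ (hCD (hxC t ht0)))), hd⟩
  have hbelow : BddBelow (range fun t => V (x (max t t₀))) := by
    refine (hC.bddBelow_image hK.continuousOn).mono ?_
    rintro _ ⟨t, rfl⟩
    exact mem_image_of_mem V (hxC _ (le_max_right _ _))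
  obtain ⟨c, hc⟩ : ∃ c, Tendsto (fun t => V (x t)) atTop (𝓝 c) := by
    refine ⟨_, (tendsto_atTop_ciInf hanti hbelow).congr' ?_⟩
    filter_upwards [eventually_ge_atTop t₀] with t ht
    rw [max_eq_left ht]
  have hxC' : ∀ᶠ t in atTop, x t ∈ C := (eventually_ge_atTop t₀).mono hxC
  have hclus : ∀ w, MapClusterPt w atTop x → w ∈ C ∧ V w = c := by
    intro w hw
    obtain ⟨𝒰, h𝒰, hw⟩ := mapClusterPt_iff_ultrafilter.1 hw
    have hwC : w ∈ C := hC.isClosed.mem_of_tendsto hw (h𝒰 hxC')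
    refine ⟨hwC, tendsto_nhds_unique ?_ (hc.mono_left h𝒰)⟩
    exact (hV.continuousOn.continuousAt (hD.mem_nhds (hCD hwC))).tendsto.comp hw
  obtain ⟨z, hz, hz0, hzcl⟩ := hx.exists_solution_of_mapClusterPt hbdd hosc hval hCD hC hxC hy
  have hzC : ∀ t, t₀ ≤ t → z t ∈ C := fun t _ => (hclus _ (hzcl t)).1
  have hzL := hlip hz hzC
  have hae : ∀ᵐ t ∂(volume : Measure ℝ), t ∈ Ici t₀ →
      z t ∈ {y | y ∈ D ∧ genDeriv F U D V y = 0} := by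
    filter_upwards [hz.ae_hasDerivAt_comp hD hU hV hCD hC hzC hzL] with t ht hmem
    obtain ⟨d, hd, hle⟩ := ht hmem
    -- The derivative along `z` is zero, so the generalized derivative is squeezed between `0` and
    -- `0`.
    have hconst : (fun s => V (z s)) = fun _ => c := funext fun s => (hclus _ (hzcl s)).2
    rw [hconst] at hd
    rw [hd.unique (hasDerivAt_const t c)] at hle
    exact ⟨hCD (hzC t hmem), le_antisymm (hVle _ (hCD (hzC t hmem))) hle⟩
  -- Good times have full measure, hence accumulate at `t₀` from the right; continuity of `z`
  -- carries this to `y = z t₀`.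
  have hdense := (Measure.dense_of_ae hae).open_subset_closure_inter (isOpen_Ioi (a := t₀))
  have ht₀ : t₀ ∈ closure (Ioi t₀ ∩ {t | t ∈ Ici t₀ →
      z t ∈ {y | y ∈ D ∧ genDeriv F U D V y = 0}}) := by
    refine isClosed_closure.closure_subset_iff.2 hdense ?_
    rw [closure_Ioi]
    exact self_mem_Ici
  rw [← hz0]
  refine ((hzL.continuousOn t₀ self_mem_Ici).mono ?_).mem_closure ht₀ ?_
  · exact fun t ht => Ioi_subset_Ici_self ht.1
  · exact fun t ht => ht.2 (Ioi_subset_Ici_self ht.1)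

end DiffIncl

/-! ### The invariance principle -/

theorem mainTheorem4 {n : ℕ} (t₀ : ℝ)
    (D : Set (DiffIncl.Rn n)) (hDopen : IsOpen D) (hDconn : IsConnected D)
    (F : DiffIncl.Rn n → Set (DiffIncl.Rn n))
    (hFbdd : DiffIncl.LocallyBoundedOn F D)
    (hFosc : DiffIncl.OuterSemicontinuousOn F D)
    (hFval : ∀ x ∈ D, (F x).Nonempty ∧ Convex ℝ (F x) ∧ IsCompact (F x))
    (U : ℕ → DiffIncl.Rn n → ℝ)
    (hU : ∀ i, LocallyLipschitzOn D (U i) ∧ DiffIncl.RegularOn (U i) D)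
    (V : DiffIncl.Rn n → ℝ) (hV : LocallyLipschitzOn D V)
    (hVle : ∀ x ∈ D, DiffIncl.genDeriv F U D V x ≤ 0)
    (C : Set (DiffIncl.Rn n)) (hCD : C ⊆ D) (hCcomp : IsCompact C)
    (hCinv : DiffIncl.StronglyForwardInvariant F t₀ C)
    (E : Set (DiffIncl.Rn n)) (hE : E = {x | x ∈ D ∧ DiffIncl.genDeriv F U D V x = 0})
    (M : Set (DiffIncl.Rn n))
    (hM : DiffIncl.IsLargestWeaklyForwardInvariant F t₀ (closure E ∩ C) M)
    (T : EReal) (x : ℝ → DiffIncl.Rn n)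
    (hx : DiffIncl.IsMaximalSolution F t₀ T x) (hxC : x t₀ ∈ C) :
    T = ⊤ ∧ Tendsto (fun t : ℝ => Metric.infEDist (x t) M) atTop (𝓝 0) := by
  subst hE
  have hxC' := hCinv T x hx hxC
  obtain rfl : T = ⊤ := hx.eq_top hDopen hFbdd hFosc hFval hCD hCcomp hxC'
  rw [DiffIncl.interval_top] at hxC'
  refine ⟨rfl, ?_⟩
  have hev : ∀ᶠ t in atTop, x t ∈ C := (eventually_ge_atTop t₀).mono hxC'
  have hsub : {y | MapClusterPt y atTop x} ⊆ M := by
    refine hM.2 ⟨fun y hy => ⟨?_, ?_⟩, fun y hy => ?_⟩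
    · exact hx.1.clusterPts_subset hDopen hFbdd hFosc hFval hU hV hVle hCD hCcomp hxC' hy
    · obtain ⟨𝒰, h𝒰, hw⟩ := mapClusterPt_iff_ultrafilter.1 hy
      exact hCcomp.isClosed.mem_of_tendsto hw (h𝒰 hev)
    · obtain ⟨z, hz, hz0, hzcl⟩ :=
        hx.1.exists_solution_of_mapClusterPt hFbdd hFosc hFval hCD hCcomp hxC' hy
      exact ⟨⊤, z, hz.isMaximalSolution_top, hz0, fun t _ => hzcl t⟩
  -- Along each ultrafilter `x` converges in `C` to a limit point, hence to a point of `M`; in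
  -- particular `M` is nonempty.
  rw [tendsto_iff_ultrafilter]
  intro 𝒰 h𝒰
  obtain ⟨y, -, hy⟩ := hCcomp.ultrafilter_le_nhds (𝒰.map x) (le_principal_iff.2 (h𝒰 hev))
  have hyM : y ∈ M := hsub (mapClusterPt_iff_ultrafilter.2 ⟨𝒰, h𝒰, hy⟩)
  have h0 : Tendsto (fun t => edist (x t) y) 𝒰 (𝓝 0) := tendsto_iff_edist_tendsto_0.1 hy
  exact tendsto_of_tendsto_of_tendsto_of_le_of_le tendsto_const_nhds h0 (fun _ => zero_le)
    fun t => Metric.infEDist_le_edist_of_mem hyM
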